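/- Let $d\ge 1$ be an integer, $\mathbb{D}=\{z\in\mathbb{C}:|z|<1\}$, and let $\overline{\mathbb{D}}$ be its closure. Let $A_{\mathrm{sym}}(\mathbb{D}^d)$ be the commutative ring, under pointwise operations, of all continuous functions $f:\overline{\mathbb{D}}^d\to\mathbb{C}$ that are holomorphic in $\mathbb{D}^d$ and symmetric, i.e. $f(z_{\sigma(1)},\dots,z_{\sigma(d)})=f(z_1,\dots,z_d)$ for all $(z_1,\dots,z_d)\in\mathbb{D}^d$ and all permutations $\sigma$ of $\{1,\dots,d\}$. A unital commutative ring $R$ is called coherent if the intersection of any two finitely generated ideals of $R$ is finitely generated and, for every $a\in R$, the annihilator $\{x\in R: ax=0\}$ is finitely generated. Then $A_{\mathrm{sym}}(\mathbb{D}^d)$ is not coherent. -/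

import Mathlib

/-- A commutative ring is coherent if the intersection of any two finitely generated ideals is
finitely generated, and the annihilator `{x | x * a = 0}` of every element `a` is finitely
generated. -/
structure IsCoherentRing (R : Type*) [CommRing R] : Prop where
  inf_fg : ∀ I J : Ideal R, I.FG → J.FG → (I ⊓ J).FG
  ann_fg : ∀ a : R, (Ideal.torsionOf R R a).FG

/-- The open unit polydisc in `ℂ^d`. -/
def polydisc (d : ℕ) : Set (Fin d → ℂ) := {z | ∀ i, ‖z i‖ < 1}

/-- The closed unit polydisc in `ℂ^d`. -/
def closedPolydisc (d : ℕ) : Set (Fin d → ℂ) := {z | ∀ i, ‖z i‖ ≤ 1}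

/-- The action of a permutation on the closed polydisc:
`σ z = (z_{σ(1)}, …, z_{σ(d)})`. -/
def permPoint {d : ℕ} (σ : Equiv.Perm (Fin d)) (z : closedPolydisc d) : closedPolydisc d :=
  ⟨fun i => z.1 (σ i), fun i => z.2 (σ i)⟩

/-- A function on the closed polydisc is holomorphic in the open polydisc: it agrees there with
a function on `ℂ^d` that is complex differentiable at each point of the (open) polydisc. The
values of the latter function off the polydisc play no role. -/
def HolomorphicInside {d : ℕ} (f : closedPolydisc d → ℂ) : Prop :=
  ∃ F : (Fin d → ℂ) → ℂ, DifferentiableOn ℂ F (polydisc d) ∧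
    ∀ z : closedPolydisc d, (z : Fin d → ℂ) ∈ polydisc d → F z = f z

/-- The polydisc algebra: continuous functions on the closed polydisc that are holomorphic in
the open polydisc, with pointwise operations. -/
def polydiscAlgebra (d : ℕ) : Subalgebra ℂ C(closedPolydisc d, ℂ) where
  carrier := {f | HolomorphicInside f}
  mul_mem' := by
    rintro f g ⟨F, hF, hFf⟩ ⟨G, hG, hGg⟩
    exact ⟨fun z => F z * G z, hF.mul hG, fun z hz => by simp [hFf z hz, hGg z hz]⟩
  add_mem' := by
    rintro f g ⟨F, hF, hFf⟩ ⟨G, hG, hGg⟩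
    exact ⟨fun z => F z + G z, hF.add hG, fun z hz => by simp [hFf z hz, hGg z hz]⟩
  algebraMap_mem' := by
    intro c
    exact ⟨fun _ => c, differentiableOn_const c, fun z _ => by simp⟩

/-- A function is symmetric if `f (σ z) = f z` for all `z` in the open polydisc and all
permutations `σ`. -/
def IsSymmetricFun {d : ℕ} (f : closedPolydisc d → ℂ) : Prop :=
  ∀ z : closedPolydisc d, (z : Fin d → ℂ) ∈ polydisc d →
    ∀ σ : Equiv.Perm (Fin d), f (permPoint σ z) = f z

/-- The algebra of symmetric functions in the polydisc algebra. -/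
def symPolydiscAlgebra (d : ℕ) : Subalgebra ℂ C(closedPolydisc d, ℂ) where
  carrier := {f | f ∈ polydiscAlgebra d ∧ IsSymmetricFun f}
  mul_mem' := by
    rintro f g ⟨hf, hf'⟩ ⟨hg, hg'⟩
    exact ⟨mul_mem hf hg, fun z hz σ => by simp [hf' z hz σ, hg' z hz σ]⟩
  add_mem' := by
    rintro f g ⟨hf, hf'⟩ ⟨hg, hg'⟩
    exact ⟨add_mem hf hg, fun z hz σ => by simp [hf' z hz σ, hg' z hz σ]⟩
  algebraMap_mem' := by
    intro c
    exact ⟨Subalgebra.algebraMap_mem _ c, fun z _ σ => by simp⟩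

open Filter Topology

/-! Let `w` be the mean of the coordinates, `S = singularInner`, `f = 1 - w`, `g = (1 - w) * S(w)`,
and let `M` be the ideal of elements vanishing at `(1, …, 1)`. The intersection of `(f)` and `(g)`
is `g * M`: if `f * u = g * v` then `u = v * S(w)`, and continuity of `u` forces `v ∈ M`
(`apply_onePt_eq_zero`); conversely `S(w) * v` is continuous for `v ∈ M`, as `S` is bounded.

If `g * M` were finitely generated, the cofactors of its generators would lie in `P * M` for a
single `P ∈ M` (`exists_common_factor`). Then `g * P ∈ g * P * M`, so some `m ∈ M` equals `1`
wherever `g * P ≠ 0`, that is, off `(1, …, 1)`, against continuity. -/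

namespace SymPolydisc

/-! ### Symmetric functions built from the mean of the coordinates -/

/-- The half plane `Re w < 1`. -/
def halfPlane : Set ℂ := {w | w.re < 1}

lemma isOpen_halfPlane : IsOpen halfPlane :=
  isOpen_lt Complex.continuous_re continuous_const

lemma one_sub_ne_zero {w : ℂ} (hw : w ∈ halfPlane) : 1 - w ≠ 0 := by
  intro h
  have : w.re < 1 := hw
  rw [← sub_eq_zero.1 h] at this
  simp at this

/-- The mean of the coordinates. -/
noncomputable def mean {d : ℕ} (z : Fin d → ℂ) : ℂ := (∑ i, z i) / d

lemma differentiable_mean {d : ℕ} : Differentiable ℂ (mean : (Fin d → ℂ) → ℂ) := by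
  unfold mean
  fun_prop

lemma mean_permPoint {d : ℕ} (σ : Equiv.Perm (Fin d)) (z : closedPolydisc d) :
    mean (permPoint σ z : Fin d → ℂ) = mean (z : Fin d → ℂ) := by
  unfold mean permPoint
  congr 1
  exact Equiv.sum_comp σ (z : Fin d → ℂ)

lemma mean_const {d : ℕ} (hd : 1 ≤ d) (c : ℂ) : mean (fun _ : Fin d => c) = c := by
  have : (d : ℂ) ≠ 0 := by exact_mod_cast (by omega : d ≠ 0)
  simp [mean, mul_div_cancel_left₀ _ this]

/-- The diagonal point with coordinate `c`. -/
def diag (d : ℕ) (c : ℂ) (hc : ‖c‖ ≤ 1) : closedPolydisc d := ⟨fun _ => c, fun _ => hc⟩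

/-- The point `(1, …, 1)` of the closed polydisc. -/
def onePt (d : ℕ) : closedPolydisc d := diag d 1 (by simp)

lemma mean_onePt {d : ℕ} (hd : 1 ≤ d) : mean (onePt d : Fin d → ℂ) = 1 := mean_const hd 1

/-- In the closed disc, real part `1` occurs only at `1`, so one coordinate other than `1` makes the
averaged bound strict, even on the boundary. -/
lemma mean_mem_halfPlane {d : ℕ} {z : closedPolydisc d} (hz : z ≠ onePt d) :
    mean (z : Fin d → ℂ) ∈ halfPlane := by
  obtain ⟨i, hi⟩ : ∃ i, z.1 i ≠ 1 := by
    by_contra! h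
    exact hz (Subtype.ext (funext h))
  have hd : (0 : ℝ) < d := by exact_mod_cast i.pos
  have hre : ∀ j, (z.1 j).re ≤ 1 := fun j => (Complex.re_le_norm _).trans (z.2 j)
  have hlt : (z.1 i).re < 1 := by
    refine lt_of_le_of_ne (hre i) fun h => hi ?_
    have h1 : ‖z.1 i‖ ^ 2 ≤ 1 := by
      have := z.2 i
      have h0 := norm_nonneg (z.1 i)
      nlinarith
    rw [Complex.sq_norm, Complex.normSq_apply, h] at h1
    have him : (z.1 i).im = 0 := by nlinarith [mul_self_nonneg (z.1 i).im]
    exact Complex.ext (by simp [h]) (by simp [him])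
  change ((∑ j, z.1 j) / (d : ℂ)).re < 1
  rw [Complex.div_natCast_re, Complex.re_sum, div_lt_one hd]
  calc ∑ j, (z.1 j).re < ∑ _j : Fin d, (1 : ℝ) :=
        Finset.sum_lt_sum (fun j _ => hre j) ⟨i, Finset.mem_univ i, hlt⟩
    _ = d := by simp

lemma ne_onePt_of_mem_polydisc {d : ℕ} (hd : 1 ≤ d) {z : closedPolydisc d}
    (hz : (z : Fin d → ℂ) ∈ polydisc d) : z ≠ onePt d := by
  rintro rfl
  have := hz ⟨0, hd⟩
  simp [onePt, diag] at this

lemma continuous_mean {d : ℕ} : Continuous fun z : closedPolydisc d => mean (z : Fin d → ℂ) :=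
  differentiable_mean.continuous.comp continuous_subtype_val

instance compactSpace_closedPolydisc (d : ℕ) : CompactSpace (closedPolydisc d) := by
  rw [← isCompact_iff_compactSpace]
  have : closedPolydisc d = Set.univ.pi fun _ => Metric.closedBall (0 : ℂ) 1 := by
    ext z
    simp [closedPolydisc]
  rw [this]
  exact isCompact_univ_pi fun _ => isCompact_closedBall _ _

/-- A function of the form `v * Φ ∘ mean` away from `(1, …, 1)`, with `Φ` holomorphic in the half
plane, belongs to the symmetric polydisc algebra as soon as it is continuous at `(1, …, 1)`. -/
lemma exists_mem_of_eq_mul_comp_mean {d : ℕ} (hd : 1 ≤ d) (v : symPolydiscAlgebra d)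
    {Φ : ℂ → ℂ} (hΦ : DifferentiableOn ℂ Φ halfPlane) (h : closedPolydisc d → ℂ)
    (heq : ∀ z, z ≠ onePt d → h z = v.1 z * Φ (mean (z : Fin d → ℂ)))
    (hc : ContinuousAt h (onePt d)) :
    ∃ H : symPolydiscAlgebra d, ∀ z, H.1 z = h z := by
  have hcont : Continuous h := by
    rw [continuous_iff_continuousAt]
    intro z
    by_cases hz : z = onePt d
    · rwa [hz]
    have h1 : ContinuousAt (fun z : closedPolydisc d => v.1 z * Φ (mean (z : Fin d → ℂ))) z := by
      refine v.1.continuous.continuousAt.mul ?_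
      exact ContinuousAt.comp (f := fun z : closedPolydisc d => mean (z : Fin d → ℂ))
        (hΦ.continuousOn.continuousAt (isOpen_halfPlane.mem_nhds (mean_mem_halfPlane hz)))
        continuous_mean.continuousAt
    refine h1.congr ?_
    filter_upwards [isOpen_ne.mem_nhds hz] with y hy using (heq y hy).symm
  obtain ⟨V, hV, hVv⟩ := v.2.1
  refine ⟨⟨⟨h, hcont⟩, ⟨fun z => V z * Φ (mean z), ?_, ?_⟩, ?_⟩, fun _ => rfl⟩
  · refine hV.mul (hΦ.comp differentiable_mean.differentiableOn ?_)
    intro z hz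
    exact mean_mem_halfPlane (z := ⟨z, fun i => (hz i).le⟩)
      (ne_onePt_of_mem_polydisc hd (z := ⟨z, fun i => (hz i).le⟩) hz)
  · intro z hz
    change _ = h z
    rw [heq z (ne_onePt_of_mem_polydisc hd hz), ← hVv z hz]
  · intro z hz σ
    have hz' : (permPoint σ z : Fin d → ℂ) ∈ polydisc d := fun i => hz (σ i)
    change h _ = h _
    rw [heq _ (ne_onePt_of_mem_polydisc hd hz), heq _ (ne_onePt_of_mem_polydisc hd hz'),
      mean_permPoint, v.2.2 z hz σ]

/-! ### The singular inner function near its singularity -/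

/-- The function `exp (-1 / (1 - w))`, holomorphic and bounded by `1` in the half plane. -/
noncomputable def singularInner (w : ℂ) : ℂ := Complex.exp (-(1 - w)⁻¹)

lemma differentiableOn_singularInner : DifferentiableOn ℂ singularInner halfPlane := by
  intro w hw
  have := one_sub_ne_zero hw
  unfold singularInner
  exact DifferentiableAt.differentiableWithinAt (by fun_prop (disch := assumption))

lemma norm_singularInner (w : ℂ) :
    ‖singularInner w‖ = Real.exp (-((1 - w.re) / Complex.normSq (1 - w))) := by
  rw [singularInner, Complex.norm_exp, Complex.neg_re, Complex.inv_re]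
  simp

lemma norm_singularInner_le {w : ℂ} (hw : w ∈ halfPlane) : ‖singularInner w‖ ≤ 1 := by
  rw [norm_singularInner, Real.exp_le_one_iff, neg_nonpos]
  exact div_nonneg (sub_nonneg.2 (le_of_lt hw)) (Complex.normSq_nonneg _)

/-- The map `w ↦ 1 / (1 - w)` sends the unit circle to the line of real part `1 / 2`. -/
lemma norm_singularInner_of_norm_eq_one {w : ℂ} (hw : ‖w‖ = 1) (hw' : w ≠ 1) :
    ‖singularInner w‖ = Real.exp (-(1 / 2)) := by
  have h0 : Complex.normSq (1 - w) ≠ 0 := by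
    rw [Ne, map_eq_zero, sub_eq_zero]
    exact hw'.symm
  have h1 : w.re * w.re + w.im * w.im = 1 := by
    rw [← Complex.normSq_apply, ← Complex.sq_norm, hw, one_pow]
  rw [norm_singularInner]
  congr 2
  rw [div_eq_div_iff h0 two_ne_zero, Complex.normSq_apply]
  simp
  linarith

lemma singularInner_ne_zero (w : ℂ) : singularInner w ≠ 0 := Complex.exp_ne_zero _

lemma norm_singularInner_real {t : ℝ} (ht : 0 < t) :
    ‖singularInner ((1 - t : ℝ) : ℂ)‖ = Real.exp (-t⁻¹) := by
  have h : (1 : ℂ) - ((1 - t : ℝ) : ℂ) = (t : ℂ) := by push_cast; ring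
  rw [norm_singularInner, h, Complex.normSq_ofReal, Complex.ofReal_re]
  congr 2
  field_simp
  ring

lemma tendsto_diag {d : ℕ} {ζ : ℕ → ℂ} (hζ : ∀ n, ‖ζ n‖ ≤ 1) (h : Tendsto ζ atTop (𝓝 1)) :
    Tendsto (fun n => diag d (ζ n) (hζ n)) atTop (𝓝 (onePt d)) := by
  rw [tendsto_subtype_rng, tendsto_pi_nhds]
  exact fun _ => h

lemma diag_ne_onePt {d : ℕ} (hd : 1 ≤ d) {c : ℂ} (hc : ‖c‖ ≤ 1) (h : c ≠ 1) :
    diag d c hc ≠ onePt d := fun h' => h (congrFun (congrArg Subtype.val h') ⟨0, hd⟩)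

/-- The sequence `1 - 1 / (n + 1)`. -/
noncomputable def radialSeq (n : ℕ) : ℂ := ((1 - 1 / ((n : ℝ) + 1) : ℝ) : ℂ)

lemma norm_radialSeq_le (n : ℕ) : ‖radialSeq n‖ ≤ 1 := by
  have h1 : 0 < 1 / ((n : ℝ) + 1) := by positivity
  have h2 : 1 / ((n : ℝ) + 1) ≤ 1 := by
    rw [div_le_one (by positivity)]
    linarith [(Nat.cast_nonneg n : (0 : ℝ) ≤ n)]
  rw [radialSeq, Complex.norm_real, Real.norm_eq_abs, abs_le]
  constructor <;> linarith

lemma radialSeq_ne_one (n : ℕ) : radialSeq n ≠ 1 := by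
  have h1 : 0 < 1 / ((n : ℝ) + 1) := by positivity
  rw [radialSeq, Ne, Complex.ofReal_eq_one]
  linarith

lemma tendsto_radialSeq : Tendsto radialSeq atTop (𝓝 1) := by
  have h : Tendsto (fun n : ℕ => 1 - 1 / ((n : ℝ) + 1)) atTop (𝓝 (1 - 0)) :=
    tendsto_const_nhds.sub tendsto_one_div_add_atTop_nhds_zero_nat
  rw [sub_zero] at h
  exact (Complex.continuous_ofReal.tendsto' 1 1 Complex.ofReal_one).comp h

/-- The sequence `exp (i / (n + 1))`. -/
noncomputable def circleSeq (n : ℕ) : ℂ := Complex.exp ((1 / ((n : ℝ) + 1) : ℝ) * Complex.I)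

lemma norm_circleSeq (n : ℕ) : ‖circleSeq n‖ = 1 := Complex.norm_exp_ofReal_mul_I _

lemma circleSeq_ne_one (n : ℕ) : circleSeq n ≠ 1 := by
  intro h
  have h1 : 0 < 1 / ((n : ℝ) + 1) := by positivity
  have h2 : 1 / ((n : ℝ) + 1) ≤ 1 := by
    rw [div_le_one (by positivity)]
    linarith [(Nat.cast_nonneg n : (0 : ℝ) ≤ n)]
  have h3 : Real.sin (1 / ((n : ℝ) + 1)) = 0 := by
    rw [← Complex.exp_ofReal_mul_I_im]
    exact (congrArg Complex.im h).trans Complex.one_im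
  exact (Real.sin_pos_of_pos_of_le_one h1 h2).ne' h3

lemma tendsto_circleSeq : Tendsto circleSeq atTop (𝓝 1) := by
  have hc : Continuous fun t : ℝ => Complex.exp (t * Complex.I) := by fun_prop
  exact (hc.tendsto' 0 1 (by simp)).comp tendsto_one_div_add_atTop_nhds_zero_nat

/-- If `u = v * singularInner ∘ mean` off `(1, …, 1)` with `u`, `v` continuous, then
`v (1, …, 1) = 0`. -/
lemma apply_onePt_eq_zero {d : ℕ} (hd : 1 ≤ d) (u v : C(closedPolydisc d, ℂ))
    (h : ∀ z, z ≠ onePt d → u z = v z * singularInner (mean (z : Fin d → ℂ))) :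
    v (onePt d) = 0 := by
  -- Along the radius the inner factor tends to `0`; along the circle its modulus is a nonzero
  -- constant. The two limits of `u` must agree.
  have hu : ‖u (onePt d)‖ = 0 := by
    have h1 := ((u.continuous.tendsto _).comp
      (tendsto_diag (d := d) norm_radialSeq_le tendsto_radialSeq)).norm
    have h2 := ((v.continuous.tendsto _).comp
      (tendsto_diag (d := d) norm_radialSeq_le tendsto_radialSeq)).norm
    have h3 : Tendsto (fun n : ℕ => ‖singularInner (radialSeq n)‖) atTop (𝓝 0) := by
      have : ∀ n : ℕ, ‖singularInner (radialSeq n)‖ = Real.exp (-((n : ℝ) + 1)) := fun n => by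
        rw [radialSeq, norm_singularInner_real (by positivity), one_div, inv_inv]
      simp_rw [this]
      exact Real.tendsto_exp_neg_atTop_nhds_zero.comp
        (tendsto_atTop_add_const_right _ _ tendsto_natCast_atTop_atTop)
    have h4 := h2.mul h3
    rw [mul_zero] at h4
    refine tendsto_nhds_unique h1 (h4.congr fun n => ?_)
    have h5 := h _ (diag_ne_onePt hd (norm_radialSeq_le n) (radialSeq_ne_one n))
    have h6 : mean (diag d (radialSeq n) (norm_radialSeq_le n) : Fin d → ℂ) = radialSeq n :=
      mean_const hd _
    rw [h6] at h5
    simp [h5]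
  have h1 := ((u.continuous.tendsto _).comp
    (tendsto_diag (d := d) (fun n => (norm_circleSeq n).le) tendsto_circleSeq)).norm
  have h2 := ((v.continuous.tendsto _).comp
    (tendsto_diag (d := d) (fun n => (norm_circleSeq n).le) tendsto_circleSeq)).norm
  have h3 := h2.mul_const (Real.exp (-(1 / 2)))
  have h4 : ‖u (onePt d)‖ = ‖v (onePt d)‖ * Real.exp (-(1 / 2)) := by
    refine tendsto_nhds_unique h1 (h3.congr fun n => ?_)
    have h5 := h _ (diag_ne_onePt hd (norm_circleSeq n).le (circleSeq_ne_one n))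
    have h6 : mean (diag d (circleSeq n) (norm_circleSeq n).le : Fin d → ℂ) = circleSeq n :=
      mean_const hd _
    rw [h6] at h5
    simp [h5, norm_singularInner_of_norm_eq_one (norm_circleSeq n) (circleSeq_ne_one n)]
  rw [hu, eq_comm, mul_eq_zero] at h4
  exact norm_eq_zero.1 (h4.resolve_right (Real.exp_pos _).ne')

/-! ### Peak functions and their sums -/

/-- The peak function `δ / (δ + 1 - w)`, equal to `1` at `w = 1`. -/
noncomputable def peak (δ : ℝ) (w : ℂ) : ℂ := δ / (δ + (1 - w))

lemma norm_le_norm_add_one_sub {δ : ℝ} (hδ : 0 ≤ δ) {w : ℂ} (hw : w.re ≤ 1) :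
    ‖1 - w‖ ≤ ‖(δ : ℂ) + (1 - w)‖ := by
  rw [Complex.norm_def, Complex.norm_def]
  refine Real.sqrt_le_sqrt ?_
  simp only [Complex.normSq_apply, Complex.add_re, Complex.sub_re, Complex.one_re,
    Complex.ofReal_re, Complex.add_im, Complex.sub_im, Complex.one_im, Complex.ofReal_im]
  nlinarith

lemma le_norm_add_one_sub {δ : ℝ} {w : ℂ} (hw : w.re ≤ 1) :
    δ ≤ ‖(δ : ℂ) + (1 - w)‖ := by
  refine le_trans ?_ (Complex.re_le_norm _)
  simp only [Complex.add_re, Complex.sub_re, Complex.one_re, Complex.ofReal_re]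
  linarith

lemma norm_peak_le_one {δ : ℝ} (hδ : 0 < δ) {w : ℂ} (hw : w.re ≤ 1) : ‖peak δ w‖ ≤ 1 := by
  have := le_norm_add_one_sub (δ := δ) hw
  rw [peak, norm_div, Complex.norm_real, Real.norm_of_nonneg hδ.le]
  exact div_le_one_of_le₀ this (norm_nonneg _)

lemma norm_peak_le_div {δ : ℝ} (hδ : 0 < δ) {w : ℂ} (hw : w.re ≤ 1) {r : ℝ} (hr : 0 < r)
    (h : r ≤ ‖1 - w‖) : ‖peak δ w‖ ≤ δ / r := by
  have := h.trans (norm_le_norm_add_one_sub hδ.le hw)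
  rw [peak, norm_div, Complex.norm_real, Real.norm_of_nonneg hδ.le]
  exact div_le_div_of_nonneg_left hδ.le hr this

lemma add_one_sub_ne_zero {δ : ℝ} (hδ : 0 < δ) {w : ℂ} (hw : w.re ≤ 1) :
    (δ : ℂ) + (1 - w) ≠ 0 :=
  norm_pos_iff.1 (hδ.trans_le (le_norm_add_one_sub hw))

lemma differentiableAt_peak {δ : ℝ} (hδ : 0 < δ) {w : ℂ} (hw : w.re ≤ 1) :
    DifferentiableAt ℂ (peak δ) w := by
  have := add_one_sub_ne_zero hδ hw
  unfold peak
  fun_prop (disch := assumption)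

lemma re_peak_nonneg {δ : ℝ} (hδ : 0 < δ) {w : ℂ} (hw : w.re ≤ 1) : 0 ≤ (peak δ w).re := by
  rw [peak, div_eq_mul_inv, Complex.re_ofReal_mul, Complex.inv_re]
  refine mul_nonneg hδ.le (div_nonneg ?_ (Complex.normSq_nonneg _))
  simp only [Complex.add_re, Complex.sub_re, Complex.one_re, Complex.ofReal_re]
  linarith

lemma peak_one {δ : ℝ} (hδ : 0 < δ) : peak δ 1 = 1 := by
  have : (δ : ℂ) ≠ 0 := by exact_mod_cast hδ.ne'
  simp [peak, this]

/-- The sum of the peak functions of a sequence of widths. -/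
noncomputable def peakSum (δ : ℕ → ℝ) (w : ℂ) : ℂ := ∑' k, peak (δ k) w

section peakSum

variable {δ : ℕ → ℝ} (hδ : ∀ k, 0 < δ k) (hs : Summable δ)

include hδ hs

lemma summable_peak {w : ℂ} (hw : w ∈ halfPlane) : Summable fun k => peak (δ k) w := by
  have h0 : 0 < ‖1 - w‖ := norm_pos_iff.2 (one_sub_ne_zero hw)
  exact Summable.of_norm_bounded (hs.div_const ‖1 - w‖)
    fun k => norm_peak_le_div (hδ k) (le_of_lt hw) h0 le_rfl

/-- Where `Re w < b < 1`, the Weierstrass test applies with bounds `δ k / (1 - b)`. -/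
lemma differentiableOn_peakSum : DifferentiableOn ℂ (peakSum δ) halfPlane := by
  intro w hw
  obtain ⟨b, hwb, hb⟩ := exists_between (show w.re < 1 from hw)
  have hopen : IsOpen {x : ℂ | x.re < b} := isOpen_lt Complex.continuous_re continuous_const
  have : DifferentiableOn ℂ (peakSum δ) {x : ℂ | x.re < b} := by
    refine Complex.differentiableOn_tsum_of_summable_norm (hs.div_const (1 - b))
      (fun k x hx => ?_) hopen (fun k x hx => ?_)
    · exact (differentiableAt_peak (hδ k)
        ((le_of_lt hx).trans hb.le)).differentiableWithinAt
    · refine norm_peak_le_div (hδ k) ((le_of_lt hx).trans hb.le) (sub_pos.2 hb) ?_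
      refine le_trans ?_ (Complex.re_le_norm _)
      have : x.re < b := hx
      simp only [Complex.sub_re, Complex.one_re]
      linarith
  exact (this.differentiableAt (hopen.mem_nhds hwb)).differentiableWithinAt

lemma sum_re_peak_le {w : ℂ} (hw : w ∈ halfPlane) (N : ℕ) :
    ∑ k ∈ Finset.range N, (peak (δ k) w).re ≤ (peakSum δ w).re := by
  have h := Complex.hasSum_re (summable_peak hδ hs hw).hasSum
  exact sum_le_hasSum _ (fun k _ => re_peak_nonneg (hδ k) (le_of_lt hw)) h

lemma one_le_re_one_add_peakSum {w : ℂ} (hw : w ∈ halfPlane) : 1 ≤ (1 + peakSum δ w).re := by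
  have := sum_re_peak_le hδ hs hw 0
  simp only [Finset.range_zero, Finset.sum_empty] at this
  simpa using this

lemma one_add_peakSum_ne_zero {w : ℂ} (hw : w ∈ halfPlane) : 1 + peakSum δ w ≠ 0 := by
  intro h
  have := one_le_re_one_add_peakSum hδ hs hw
  rw [h] at this
  norm_num at this

/-- Every peak has nonnegative real part and equals `1` at `1`, so near `1` the first `N` peaks
alone push the real part of the sum past any `C < N`. -/
lemma tendsto_inv_one_add_peakSum :
    Tendsto (fun w => (1 + peakSum δ w)⁻¹) (𝓝[halfPlane] 1) (𝓝 0) := by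
  refine tendsto_inv₀_cobounded.comp ?_
  rw [← tendsto_norm_atTop_iff_cobounded]
  rw [tendsto_atTop]
  intro C
  obtain ⟨N, hN⟩ := exists_nat_gt C
  have hc : ContinuousAt (fun w => ∑ k ∈ Finset.range N, (peak (δ k) w).re) 1 := by
    refine tendsto_finsetSum _ fun k _ => ?_
    exact Complex.continuous_re.continuousAt.comp
      (differentiableAt_peak (hδ k) (by simp)).continuousAt
  have h1 : ∀ᶠ w in 𝓝 (1 : ℂ), C < ∑ k ∈ Finset.range N, (peak (δ k) w).re := by
    refine hc.eventually (lt_mem_nhds ?_)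
    simpa [peak_one (hδ _)] using hN
  filter_upwards [nhdsWithin_le_nhds h1, self_mem_nhdsWithin] with w hw hw'
  have h2 := sum_re_peak_le hδ hs hw' N
  have h3 := Complex.re_le_norm (1 + peakSum δ w)
  simp only [Complex.add_re, Complex.one_re] at h3
  linarith

end peakSum

/-! ### Common factors in the ideal of a boundary point -/

/-- A narrow enough peak makes a continuous function vanishing at `(1, …, 1)` small. -/
lemma exists_mul_norm_peak_le {d : ℕ} (V : C(closedPolydisc d, ℝ)) (hV : ∀ z, 0 ≤ V z)
    (hd : 1 ≤ d) (hV1 : V (onePt d) = 0) {ε : ℝ} (hε : 0 < ε) :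
    ∃ δ, 0 < δ ∧ δ ≤ ε ∧ ∀ z : closedPolydisc d, V z * ‖peak δ (mean (z : Fin d → ℂ))‖ ≤ ε := by
  have hre : ∀ z : closedPolydisc d, (mean (z : Fin d → ℂ)).re ≤ 1 := fun z => by
    by_cases hz : z = onePt d
    · rw [hz, mean_onePt hd, Complex.one_re]
    · exact le_of_lt (mean_mem_halfPlane hz)
  have hK : IsCompact {z : closedPolydisc d | ε ≤ V z} :=
    (isClosed_le continuous_const V.continuous).isCompact
  obtain ⟨r, hr, hrle⟩ : ∃ r, 0 < r ∧ ∀ z ∈ {z : closedPolydisc d | ε ≤ V z},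
      r ≤ ‖1 - mean (z : Fin d → ℂ)‖ := by
    refine hK.exists_forall_le' (continuous_const.sub continuous_mean).norm.continuousOn ?_
    intro z hz
    refine norm_pos_iff.2 (one_sub_ne_zero (mean_mem_halfPlane ?_))
    rintro rfl
    have : ε ≤ V (onePt d) := hz
    linarith
  obtain ⟨B, hB⟩ := (isCompact_range V.continuous).bddAbove
  have hB' : ∀ z, V z ≤ B := fun z => hB ⟨z, rfl⟩
  have hB0 : 0 ≤ B := (hV (onePt d)).trans (hB' _)
  -- The bound by `ε` later makes the widths summable; the other handles the compact set where `V ≥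
  -- ε`, with `B + 1` because `B` may be `0`.
  have hδ : 0 < min ε (ε * r / (B + 1)) := lt_min hε (by positivity)
  refine ⟨min ε (ε * r / (B + 1)), hδ, min_le_left _ _, fun z => ?_⟩
  rcases le_or_gt ε (V z) with hz | hz
  · calc V z * ‖peak _ (mean (z : Fin d → ℂ))‖
        ≤ B * (min ε (ε * r / (B + 1)) / r) :=
          mul_le_mul (hB' z) (norm_peak_le_div hδ (hre z) hr (hrle z hz)) (norm_nonneg _) hB0
      _ ≤ B * ((ε * r / (B + 1)) / r) := by gcongr; exact min_le_right _ _
      _ = ε * (B / (B + 1)) := by field_simp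
      _ ≤ ε * 1 := by
          gcongr
          exact div_le_one_of_le₀ (by linarith) (by linarith)
      _ = ε := mul_one ε
  · calc V z * ‖peak _ (mean (z : Fin d → ℂ))‖ ≤ ε * 1 :=
          mul_le_mul hz.le (norm_peak_le_one hδ (hre z)) (norm_nonneg _) hε.le
      _ = ε := mul_one ε

/-- Evaluation at `(1, …, 1)`. -/
noncomputable def evalOne (d : ℕ) : symPolydiscAlgebra d →+* ℂ where
  toFun v := v.1 (onePt d)
  map_one' := rfl
  map_mul' _ _ := rfl
  map_zero' := rfl
  map_add' _ _ := rfl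

/-- Finitely many elements vanishing at `(1, …, 1)` have a common factor `P` vanishing there, with
cofactors vanishing there too; moreover `P` has no other zeros. -/
lemma exists_common_factor {d : ℕ} (hd : 1 ≤ d) (T : Finset (symPolydiscAlgebra d))
    (hT : ∀ v ∈ T, evalOne d v = 0) :
    ∃ P : symPolydiscAlgebra d, evalOne d P = 0 ∧ (∀ z, z ≠ onePt d → P.1 z ≠ 0) ∧
      ∀ v ∈ T, ∃ m, evalOne d m = 0 ∧ v = P * m := by
  -- Dominating all of `T` at once lets one sequence of widths serve every `v`.
  let V : C(closedPolydisc d, ℝ) := ⟨fun z => ∑ v ∈ T, ‖v.1 z‖, by fun_prop⟩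
  have hV0 : ∀ z, 0 ≤ V z := fun z => Finset.sum_nonneg fun _ _ => norm_nonneg _
  have hV1 : V (onePt d) = 0 := Finset.sum_eq_zero fun v hv => norm_eq_zero.2 (hT v hv)
  choose δ hδ hδle hδV using fun k : ℕ =>
    exists_mul_norm_peak_le V hV0 hd hV1 (show (0 : ℝ) < (1 / 2) ^ k by positivity)
  have hs : Summable δ := Summable.of_nonneg_of_le (fun k => (hδ k).le) hδle summable_geometric_two
  have hdiff := differentiableOn_peakSum hδ hs
  classical
  let p : closedPolydisc d → ℂ := fun z =>
    if z = onePt d then 0 else (1 + peakSum δ (mean (z : Fin d → ℂ)))⁻¹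
  have hp : ∀ z, z ≠ onePt d → p z = (1 + peakSum δ (mean (z : Fin d → ℂ)))⁻¹ :=
    fun z hz => if_neg hz
  have hp1 : p (onePt d) = 0 := if_pos rfl
  have hpc : ContinuousAt p (onePt d) := by
    rw [continuousAt_iff_punctured_nhds, hp1]
    have h1 : Tendsto (fun z : closedPolydisc d => mean (z : Fin d → ℂ)) (𝓝[≠] onePt d)
        (𝓝[halfPlane] 1) := by
      refine tendsto_nhdsWithin_iff.2 ⟨?_, ?_⟩
      · have := (continuous_mean (d := d)).tendsto (onePt d)
        rw [mean_onePt hd] at this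
        exact this.mono_left nhdsWithin_le_nhds
      · filter_upwards [self_mem_nhdsWithin] with z hz using mean_mem_halfPlane hz
    refine ((tendsto_inv_one_add_peakSum hδ hs).comp h1).congr' ?_
    filter_upwards [self_mem_nhdsWithin] with z hz using (hp z hz).symm
  obtain ⟨P, hP⟩ := exists_mem_of_eq_mul_comp_mean hd 1
    (Φ := fun w => (1 + peakSum δ w)⁻¹)
    ((hdiff.const_add 1).inv fun w hw => one_add_peakSum_ne_zero hδ hs hw) p
    (fun z hz => by rw [hp z hz]; simp) hpc
  refine ⟨P, (hP _).trans hp1, fun z hz => ?_, fun v hv => ?_⟩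
  · rw [hP, hp z hz]
    exact inv_ne_zero (one_add_peakSum_ne_zero hδ hs (mean_mem_halfPlane hz))
  have hv1 : v.1 (onePt d) = 0 := hT v hv
  have hpeak : ∀ k, Continuous fun z : closedPolydisc d => peak (δ k) (mean (z : Fin d → ℂ)) := by
    intro k
    rw [continuous_iff_continuousAt]
    intro z
    refine ContinuousAt.comp (f := fun z : closedPolydisc d => mean (z : Fin d → ℂ))
      (differentiableAt_peak (hδ k) ?_).continuousAt continuous_mean.continuousAt
    by_cases hz : z = onePt d
    · rw [hz, mean_onePt hd, Complex.one_re]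
    · exact le_of_lt (mean_mem_halfPlane hz)
  -- The cofactor is `v / P`; the widths bound the `k`-th term of its series by `(1 / 2) ^ k`, so it
  -- converges uniformly up to the boundary.
  have hc : Continuous fun z : closedPolydisc d =>
      v.1 z * (1 + peakSum δ (mean (z : Fin d → ℂ))) := by
    simp_rw [mul_add, mul_one, peakSum, ← tsum_mul_left]
    refine v.1.continuous.add (continuous_tsum (fun k => v.1.continuous.mul (hpeak k))
      summable_geometric_two fun k z => ?_)
    rw [norm_mul]
    refine le_trans ?_ (hδV k z)
    gcongr
    exact Finset.single_le_sum (f := fun v : symPolydiscAlgebra d => ‖v.1 z‖)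
      (fun _ _ => norm_nonneg _) hv
  obtain ⟨m, hm⟩ := exists_mem_of_eq_mul_comp_mean hd v (hdiff.const_add 1) _
    (fun z _ => rfl) hc.continuousAt
  refine ⟨m, ?_, ?_⟩
  · change m.1 (onePt d) = 0
    rw [hm, hv1, zero_mul]
  · refine Subtype.ext (ContinuousMap.ext fun z => ?_)
    change v.1 z = P.1 z * m.1 z
    rw [hP, hm]
    by_cases hz : z = onePt d
    · rw [hz, hv1]
      simp
    · have := one_add_peakSum_ne_zero hδ hs (mean_mem_halfPlane hz)
      rw [hp z hz]
      field_simp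

end SymPolydisc

/-! ### Failure of coherence -/

open SymPolydisc in
theorem corollary6p4 (d : ℕ) (hd : 1 ≤ d) :
    ¬ IsCoherentRing (symPolydiscAlgebra d) := by
  intro hcoh
  have hmean : Tendsto (fun z : closedPolydisc d => 1 - mean (z : Fin d → ℂ)) (𝓝 (onePt d))
      (𝓝 0) :=
    (continuous_const.sub continuous_mean).tendsto' _ _ (by simp [mean_onePt hd])
  have hsub : Differentiable ℂ fun w : ℂ => 1 - w := by fun_prop
  obtain ⟨f, hf⟩ := exists_mem_of_eq_mul_comp_mean hd 1 hsub.differentiableOn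
    (fun z => 1 - mean (z : Fin d → ℂ)) (fun z _ => by simp)
    (continuous_const.sub continuous_mean).continuousAt
  obtain ⟨g, hg⟩ := exists_mem_of_eq_mul_comp_mean hd 1
    (hsub.differentiableOn.mul differentiableOn_singularInner)
    (fun z => (1 - mean (z : Fin d → ℂ)) * singularInner (mean (z : Fin d → ℂ)))
    (fun z _ => by simp) (by
      rw [continuousAt_iff_punctured_nhds, mean_onePt hd, sub_self, zero_mul]
      refine squeeze_zero_norm' ?_ (by simpa using (hmean.mono_left nhdsWithin_le_nhds).norm)
      filter_upwards [self_mem_nhdsWithin] with z hz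
      rw [norm_mul]
      exact mul_le_of_le_one_right (norm_nonneg _)
        (norm_singularInner_le (mean_mem_halfPlane hz)))
  have hmul : ∀ v, evalOne d v = 0 → g * v ∈ Ideal.span {f} ⊓ Ideal.span {g} := by
    intro v hv
    have hv1 : v.1 (onePt d) = 0 := hv
    -- Since `v` vanishes at `(1, …, 1)`, it absorbs the discontinuity of the bounded inner factor.
    obtain ⟨u, hu⟩ := exists_mem_of_eq_mul_comp_mean hd v differentiableOn_singularInner _
      (fun z _ => rfl) (by
        rw [continuousAt_iff_punctured_nhds, hv1, zero_mul]
        have h := ((v.1.continuous.tendsto (onePt d)).mono_left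
          (nhdsWithin_le_nhds (s := {onePt d}ᶜ))).norm
        rw [hv1, norm_zero] at h
        refine squeeze_zero_norm' ?_ h
        filter_upwards [self_mem_nhdsWithin] with z hz
        rw [norm_mul]
        exact mul_le_of_le_one_right (norm_nonneg _)
          (norm_singularInner_le (mean_mem_halfPlane hz)))
    refine ⟨Ideal.mem_span_singleton'.2 ⟨u, ?_⟩, Ideal.mem_span_singleton.2 ⟨v, rfl⟩⟩
    refine Subtype.ext (ContinuousMap.ext fun z => ?_)
    change u.1 z * f.1 z = g.1 z * v.1 z
    rw [hu, hf, hg]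
    ring
  have hdvd : ∀ t ∈ Ideal.span {f} ⊓ Ideal.span {g}, ∃ v, evalOne d v = 0 ∧ t = g * v := by
    rintro t ⟨htf, htg⟩
    obtain ⟨u, rfl⟩ := Ideal.mem_span_singleton.1 htf
    obtain ⟨v, hv⟩ := Ideal.mem_span_singleton.1 htg
    refine ⟨v, apply_onePt_eq_zero hd u.1 v.1 fun z hz => ?_, hv⟩
    have h : f.1 z * u.1 z = g.1 z * v.1 z := DFunLike.congr_fun (congrArg Subtype.val hv) z
    rw [hf, hg] at h
    have h0 := one_sub_ne_zero (mean_mem_halfPlane hz)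
    refine mul_left_cancel₀ h0 ?_
    rw [h]
    ring
  obtain ⟨T, hT⟩ := hcoh.inf_fg _ _ (Submodule.fg_span_singleton f)
    (Submodule.fg_span_singleton g)
  classical
  choose! c hc hc' using fun t (ht : t ∈ T) => hdvd t (hT ▸ Ideal.subset_span ht)
  obtain ⟨P, hP1, hP0, hPm⟩ := exists_common_factor hd (T.image c) (Finset.forall_mem_image.2 hc)
  have hle : Ideal.span (T : Set (symPolydiscAlgebra d)) ≤
      Ideal.span {g * P} * RingHom.ker (evalOne d) := by
    refine Ideal.span_le.2 fun t ht => ?_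
    obtain ⟨m, hm, hm'⟩ := hPm _ (Finset.mem_image_of_mem c ht)
    refine Ideal.mem_span_singleton_mul.2 ⟨m, hm, ?_⟩
    rw [hc' t ht, hm', mul_assoc]
  have hmem : g * P ∈ Ideal.span (T : Set (symPolydiscAlgebra d)) := hT ▸ hmul P hP1
  obtain ⟨m, hm, hm'⟩ := Ideal.mem_span_singleton_mul.1 (hle hmem)
  have hm1 : ∀ z, z ≠ onePt d → m.1 z = 1 := by
    intro z hz
    have h : g.1 z * P.1 z * m.1 z = g.1 z * P.1 z :=
      DFunLike.congr_fun (congrArg Subtype.val hm') z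
    have hne : g.1 z * P.1 z ≠ 0 := by
      rw [hg]
      exact mul_ne_zero (mul_ne_zero (one_sub_ne_zero (mean_mem_halfPlane hz))
        (singularInner_ne_zero _)) (hP0 z hz)
    exact (mul_eq_left₀ hne).1 h
  -- The point `(1, …, 1)` is a limit of diagonal points where `m` is `1`.
  have hlim := (m.1.continuous.tendsto _).comp
    (tendsto_diag (d := d) norm_radialSeq_le tendsto_radialSeq)
  have hlim' : Tendsto (m.1 ∘ fun n => diag d (radialSeq n) (norm_radialSeq_le n)) atTop (𝓝 1) :=
    tendsto_const_nhds.congr fun n =>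
      (hm1 _ (diag_ne_onePt hd (norm_radialSeq_le n) (radialSeq_ne_one n))).symm
  have h01 : m.1 (onePt d) = 1 := tendsto_nhds_unique hlim hlim'
  have h00 : m.1 (onePt d) = 0 := hm
  exact one_ne_zero (h01.symm.trans h00)
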